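/- Let $X$ be a (Hausdorff, second countable, finite-dimensional) complex manifold and let $\Omega\subsetneq X$ be a Kobayashi hyperbolic domain, i.e. a nonempty connected open set on which the Kobayashi pseudodistance $\mathsf{k}_\Omega$ (the infimum of the Poincaré lengths of chains of holomorphic discs in $\Omega$, with $\omega(0,t)=\tfrac12\log\tfrac{1+t}{1-t}$ for $0\le t<1$ on the unit disc) is a distance. Let $(K_j)$ be a compact exhaustion of the closure $\overline\Omega$ of $\Omega$ in $X$, with $K_j\subset \mathrm{int}(K_{j+1})$, the interior being taken in $\overline\Omega$. An end of $\overline\Omega$ is a sequence $e=(F_j)$ where $F_j$ is a connected component of $\overline\Omega\setminus K_j$ and $F_{j+1}\subset F_j$ for all $j$. The end compactification $\overline\Omega^{\rm End}$ is the disjoint union of $\overline\Omega$ and the set of ends, where a set is open iff it contains with each $y\in\overline\Omega$ a neighbourhood of $y$ in $\overline\Omega$, and with each end $e=(F_j)$ some set $\widehat F_j$ consisting of $F_j$ and all ends $(G_\nu)$ with $G_\nu=F_\nu$ for all $\nu\le j$. Assume that $\overline\Omega^{\rm End}$ is sequentially compact, and put $\partial\overline\Omega^{\rm End}=\overline\Omega^{\rm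 End}\setminus\Omega$. Let $C_*(\Omega)$ be the space of continuous real functions on $(\Omega,\mathsf{k}_\Omega)$ with the topology of locally uniform convergence, modulo constants, with the quotient topology; let $i_{\mathsf k}(z)=[\mathsf{k}_\Omega(z,\cdot)]$, and let $\overline\Omega^{\mathsf k}$ be the closure of $i_{\mathsf k}(\Omega)$ in $C_*(\Omega)$. For $p\in\Omega$, $\xi\in\overline\Omega^{\mathsf k}\setminus i_{\mathsf k}(\Omega)$ and $R>0$ let $h_{p,\xi}$ be the representative of $\xi$ that vanishes at $p$, and let $$H_p(\xi,R)=\{z\in\Omega : h_{p,\xi}(z)<\tfrac12\log R\}.$$ For $x\in\partial\overline\Omega^{\rm End}$ let $$H^b_p(x,R)=\Big\{z\in\Omega:\liminf_{w\to x,\,w\in\Omega}\big(\mathsf{k}_\Omega(z,w)-\mathsf{k}_\Omega(p,w)\big)<\tfrac12\log R\Big\},$$ $$H^s_p(x,R)=\Big\{z\in\Omega:\limsup_{w\to x,\,w\in\Omega}\big(\mathsf{k}_\Omega(z,w)-\mathsf{k}_\Omega(p,w)\big)<\tfrac12\log R\Big\},$$ and let $\mathscr H(x)$ be the set of all $\xi\in\overline\Omega^{\mathsf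 k}\setminus i_{\mathsf k}(\Omega)$ for which there is a sequence $(x_n)$ in $\Omega$ with $x_n\to x$ in $\overline\Omega^{\rm End}$ and $i_{\mathsf k}(x_n)\to\xi$. Then, for all $p\in\Omega$, $R>0$ and $x\in\partial\overline\Omega^{\rm End}$, $$H^b_p(x,R)=\bigcup_{\xi\in\mathscr H(x)}H_p(\xi,R)\qquad\text{and}\qquad H^s_p(x,R)=\bigcap_{\xi\in\mathscr H(x)}H_p(\xi,R).$$ -/

import Mathlib

open Set Filter Topology Manifold

namespace Horospheres

/-! ### The Kobayashi distance -/

/-- The Poincaré distance of the unit disc,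
`(1 / 2) log ((1 + δ) / (1 - δ))` with `δ = |(a - b) / (1 - conj b * a)|`. -/
noncomputable def poincareDist (a b : ℂ) : ℝ :=
  Real.artanh ‖(a - b) / (1 - (starRingEnd ℂ) b * a)‖

/-- `DiscChain E Ω z w L`: there is a finite chain of holomorphic discs
`f₁, …, f_m : 𝔻 → Ω` and points `a_i, b_i ∈ 𝔻` with `f₁ a₁ = z`, `f_i b_i = f_{i+1} a_{i+1}`,
`f_m b_m = w` and `∑ poincareDist a_i b_i = L`.
Here `X` is a manifold modelled on the complex vector space `E` and `Ω` is an open subset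
of `X`. -/
inductive DiscChain (E : Type*) [NormedAddCommGroup E] [NormedSpace ℂ E]
    {X : Type*} [TopologicalSpace X] [ChartedSpace E X] (Ω : Set X) : X → X → ℝ → Prop
  | nil (z : X) (hz : z ∈ Ω) : DiscChain E Ω z z 0
  | cons (f : ℂ → X) (a b : ℂ) (w : X) (L : ℝ)
      (hf : MDifferentiableOn 𝓘(ℂ, ℂ) 𝓘(ℂ, E) f (Metric.ball 0 1))
      (hmaps : MapsTo f (Metric.ball 0 1) Ω)
      (ha : a ∈ Metric.ball (0 : ℂ) 1) (hb : b ∈ Metric.ball (0 : ℂ) 1)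
      (h : DiscChain E Ω (f b) w L) :
      DiscChain E Ω (f a) w (poincareDist a b + L)

/-- The Kobayashi (pseudo)distance of the open set `Ω`: the infimum of the lengths of the
chains of holomorphic discs in `Ω` from `z` to `w`. -/
noncomputable def kobayashiDist (E : Type*) [NormedAddCommGroup E] [NormedSpace ℂ E]
    {X : Type*} [TopologicalSpace X] [ChartedSpace E X] (Ω : Set X) (z w : X) : ℝ :=
  sInf {L : ℝ | DiscChain E Ω z w L}

/-- `Ω` is a Kobayashi hyperbolic domain of `X`: a nonempty connected open set on which the
Kobayashi pseudodistance is a distance. -/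
structure IsHyperbolicDomain (E : Type*) [NormedAddCommGroup E] [NormedSpace ℂ E]
    {X : Type*} [TopologicalSpace X] [ChartedSpace E X] (Ω : Set X) : Prop where
  isOpen : IsOpen Ω
  isConnected : IsConnected Ω
  eq_of_kobayashiDist_eq_zero :
    ∀ z ∈ Ω, ∀ w ∈ Ω, kobayashiDist E Ω z w = 0 → z = w

section KobayashiFacts

variable {E : Type*} [NormedAddCommGroup E] [NormedSpace ℂ E]
  {X : Type*} [TopologicalSpace X] [ChartedSpace E X] {Ω : Set X}

theorem poincareDist_nonneg (a b : ℂ) : 0 ≤ poincareDist a b :=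
  Real.artanh_nonneg (norm_nonneg _)

theorem poincareDist_comm (a b : ℂ) : poincareDist a b = poincareDist b a := by
  have h : ‖1 - (starRingEnd ℂ) b * a‖ = ‖1 - (starRingEnd ℂ) a * b‖ := by
    rw [← Complex.norm_conj]
    simp [mul_comm]
  simp only [poincareDist, norm_div, h, norm_sub_rev a b]

theorem DiscChain.nonneg {z w : X} {L : ℝ} (h : DiscChain E Ω z w L) : 0 ≤ L := by
  induction h with
  | nil => exact le_rfl
  | cons f a b w L hf hmaps ha hb h ih => exact add_nonneg (poincareDist_nonneg a b) ih

theorem DiscChain.append {u v w : X} {L M : ℝ} (h : DiscChain E Ω u v L)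
    (h' : DiscChain E Ω v w M) : DiscChain E Ω u w (L + M) := by
  induction h with
  | nil => simpa using h'
  | cons f a b w L hf hmaps ha hb h ih =>
    rw [add_assoc]
    exact .cons f a b _ _ hf hmaps ha hb (ih h')

theorem DiscChain.reverse {z w : X} {L : ℝ} (h : DiscChain E Ω z w L) :
    DiscChain E Ω w z L := by
  induction h with
  | nil z hz => exact .nil z hz
  | cons f a b w L hf hmaps ha hb h ih =>
    have h1 : DiscChain E Ω (f b) (f a) (poincareDist b a + 0) :=
      .cons f b a _ _ hf hmaps hb ha (.nil _ (hmaps ha))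
    have h2 := ih.append h1
    rwa [add_zero, add_comm, poincareDist_comm] at h2

theorem exists_discChain [IsManifold 𝓘(ℂ, E) 1 X] (ho : IsOpen Ω) (hc : IsConnected Ω)
    {z w : X} (hz : z ∈ Ω) (hw : w ∈ Ω) : ∃ L, DiscChain E Ω z w L := by
  refine hc.isPreconnected.induction₂ (fun z w => ∃ L, DiscChain E Ω z w L) ?_ ?_ ?_ hz hw
  · intro x hx
    set φ := chartAt E x with hφ
    have hU : IsOpen (φ.target ∩ φ.symm ⁻¹' Ω) := φ.isOpen_inter_preimage_symm ho
    have hxU : φ x ∈ φ.target ∩ φ.symm ⁻¹' Ω := by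
      refine ⟨mem_chart_target E x, ?_⟩
      rw [mem_preimage, φ.left_inv (mem_chart_source E x)]
      exact hx
    obtain ⟨r, hr, hball⟩ := Metric.isOpen_iff.1 hU _ hxU
    have h1 : ∀ᶠ y in 𝓝 x, y ∈ φ.source := φ.open_source.mem_nhds (mem_chart_source E x)
    have h2 : ∀ᶠ y in 𝓝 x, φ y ∈ Metric.ball (φ x) (r / 2) :=
      (φ.continuousAt (mem_chart_source E x)).eventually
        (Metric.ball_mem_nhds _ (half_pos hr))
    filter_upwards [mem_nhdsWithin_of_mem_nhds h1, mem_nhdsWithin_of_mem_nhds h2] with y hy hy'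
    let g : ℂ → E := fun ζ => φ x + ζ • ((2 : ℂ) • (φ y - φ x))
    have hg : MapsTo g (Metric.ball 0 1) (φ.target ∩ φ.symm ⁻¹' Ω) := by
      intro ζ hζ
      refine hball ?_
      rw [mem_ball_iff_norm] at hy' ⊢
      rw [mem_ball_zero_iff] at hζ
      have : ‖g ζ - φ x‖ = ‖ζ‖ * (2 * ‖φ y - φ x‖) := by
        simp [g, norm_smul]
      rw [this]
      nlinarith [norm_nonneg ζ, norm_nonneg (φ y - φ x)]
    have hgd : MDifferentiableOn 𝓘(ℂ, ℂ) 𝓘(ℂ, E) g (Metric.ball 0 1) := by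
      refine DifferentiableOn.mdifferentiableOn ?_
      fun_prop
    have hf : MDifferentiableOn 𝓘(ℂ, ℂ) 𝓘(ℂ, E) (φ.symm ∘ g) (Metric.ball 0 1) :=
      (mdifferentiableOn_atlas_symm (chart_mem_atlas E x)).comp hgd fun ζ hζ => (hg hζ).1
    have hfm : MapsTo (φ.symm ∘ g) (Metric.ball 0 1) Ω := fun ζ hζ => (hg hζ).2
    have h0 : (0 : ℂ) ∈ Metric.ball (0 : ℂ) 1 := by simp
    have h12 : (1 / 2 : ℂ) ∈ Metric.ball (0 : ℂ) 1 := by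
      rw [mem_ball_zero_iff]; norm_num
    have e0 : (φ.symm ∘ g) 0 = x := by
      simp only [g, Function.comp, zero_smul, add_zero]
      exact φ.left_inv (mem_chart_source E x)
    have e1 : (φ.symm ∘ g) (1 / 2) = y := by
      have : g (1 / 2) = φ y := by
        simp only [g, smul_smul]
        norm_num
      simp only [Function.comp, this]
      exact φ.left_inv hy
    have h := DiscChain.cons _ 0 (1 / 2) _ 0 hf hfm h0 h12 (.nil _ (hfm h12))
    rw [e0, e1] at h
    exact ⟨_, h⟩
  · rintro x y z hx hy hz ⟨L, hL⟩ ⟨M, hM⟩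
    exact ⟨_, hL.append hM⟩
  · rintro x y hx hy ⟨L, hL⟩
    exact ⟨_, hL.reverse⟩

theorem bddBelow_discChain (z w : X) : BddBelow {L : ℝ | DiscChain E Ω z w L} :=
  ⟨0, fun _ h => h.nonneg⟩

end KobayashiFacts

/-- The points of a hyperbolic domain `Ω`, as a metric space with the Kobayashi distance. -/
structure KobayashiSpace {E : Type*} [NormedAddCommGroup E] [NormedSpace ℂ E]
    {X : Type*} [TopologicalSpace X] [ChartedSpace E X] {Ω : Set X}
    (hΩ : IsHyperbolicDomain E Ω) where
  val : X
  property : val ∈ Ω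

noncomputable instance {E : Type*} [NormedAddCommGroup E] [NormedSpace ℂ E]
    {X : Type*} [TopologicalSpace X] [ChartedSpace E X] [IsManifold 𝓘(ℂ, E) 1 X] {Ω : Set X}
    (hΩ : IsHyperbolicDomain E Ω) : MetricSpace (KobayashiSpace hΩ) where
  dist z w := kobayashiDist E Ω z.val w.val
  dist_self z := by
    refine le_antisymm (csInf_le (bddBelow_discChain _ _) (.nil _ z.property)) ?_
    exact Real.sInf_nonneg fun _ h => DiscChain.nonneg h
  dist_comm z w := by
    simp only [kobayashiDist]
    congr 1
    ext L
    exact ⟨DiscChain.reverse, DiscChain.reverse⟩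
  dist_triangle u v w := by
    have h1 := exists_discChain (E := E) hΩ.isOpen hΩ.isConnected u.property v.property
    have h2 := exists_discChain (E := E) hΩ.isOpen hΩ.isConnected v.property w.property
    refine le_of_forall_pos_lt_add fun ε hε => ?_
    obtain ⟨L, hL, hL'⟩ := exists_lt_of_csInf_lt h1
      (lt_add_of_pos_right (kobayashiDist E Ω u.val v.val) (half_pos hε))
    obtain ⟨M, hM, hM'⟩ := exists_lt_of_csInf_lt h2
      (lt_add_of_pos_right (kobayashiDist E Ω v.val w.val) (half_pos hε))
    have h3 : kobayashiDist E Ω u.val w.val ≤ L + M :=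
      csInf_le (bddBelow_discChain _ _) (DiscChain.append hL hM)
    linarith
  eq_of_dist_eq_zero {z w} h := by
    have h' := hΩ.eq_of_kobayashiDist_eq_zero _ z.property _ w.property h
    cases z; cases w; simpa using h'

/-! ### The metric compactification -/

section MetricCompactification

variable (Y : Type*) [MetricSpace Y]

/-- The subgroup of constant functions of `C(Y, ℝ)`. -/
def constantFunctions : AddSubgroup C(Y, ℝ) where
  carrier := {f | ∃ c : ℝ, f = ContinuousMap.const Y c}
  zero_mem' := ⟨0, rfl⟩
  add_mem' := by
    rintro _ _ ⟨c, rfl⟩ ⟨d, rfl⟩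
    exact ⟨c + d, rfl⟩
  neg_mem' := by
    rintro _ ⟨c, rfl⟩
    exact ⟨-c, rfl⟩

/-- `C_*(Y)`: continuous functions modulo constants, with the quotient topology of the
compact-open topology (which is that of locally uniform convergence when `Y` is locally
compact, as is every hyperbolic domain with its Kobayashi distance). -/
abbrev FunctionsModConstants : Type _ := C(Y, ℝ) ⧸ constantFunctions Y

variable {Y}

/-- The map `i_d : Y → C_*(Y)`, `y ↦ [dist y ·]`. -/
noncomputable def metricEmbedding (y : Y) : FunctionsModConstants Y :=
  QuotientAddGroup.mk (⟨fun z => dist y z, by fun_prop⟩ : C(Y, ℝ))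

variable (Y) in
/-- The metric compactification of `Y`: the closure of `i_d(Y)` in `C_*(Y)`. -/
def metricCompactification : Set (FunctionsModConstants Y) :=
  closure (range (metricEmbedding (Y := Y)))

variable (Y) in
/-- The metric boundary of `Y`. -/
def metricBoundary : Set (FunctionsModConstants Y) :=
  metricCompactification Y \ range (metricEmbedding (Y := Y))

/-- The normalization `C(Y, ℝ) → C(Y, ℝ)`, `f ↦ f - f p`. -/
def normalizeAt (p : Y) : C(Y, ℝ) →+ C(Y, ℝ) where
  toFun f := f - ContinuousMap.const Y (f p)
  map_zero' := by ext; simp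
  map_add' f g := by ext; simp; ring

/-- The unique representative of the class `ξ ∈ C_*(Y)` that vanishes at `p`; for `ξ` in the
metric boundary this is the horofunction `h_{p,ξ}`. -/
def horofunction (p : Y) (ξ : FunctionsModConstants Y) : C(Y, ℝ) :=
  QuotientAddGroup.lift (constantFunctions Y) (normalizeAt p)
    (by rintro _ ⟨c, rfl⟩; ext; simp [normalizeAt]) ξ

/-- The horoball with pole `p`, center `ξ` and radius `R`. -/
def horoball (p : Y) (ξ : FunctionsModConstants Y) (R : ℝ) : Set Y :=
  {z | horofunction p ξ z < 1 / 2 * Real.log R}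

end MetricCompactification

/-! ### The end compactification -/

section EndCompactification

variable {S : Type*} [TopologicalSpace S]

/-- An end of `S`, with respect to the compact exhaustion `K`: a decreasing sequence `(F_j)`
where `F_j` is a connected component of `S \ K_j`. -/
@[ext]
structure SpaceEnd (K : CompactExhaustion S) where
  comp : ℕ → Set S
  isComponent : ∀ j, ∃ x ∈ (K j)ᶜ, comp j = connectedComponentIn (K j)ᶜ x
  succ_subset : ∀ j, comp (j + 1) ⊆ comp j

/-- The disjoint union of `S` and its set of ends. -/
inductive EndCompactification (K : CompactExhaustion S)
  | point (x : S) : EndCompactification K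
  | atEnd (e : SpaceEnd K) : EndCompactification K

/-- The basic neighbourhood of the end `e = (F_j)`: the set `F_j` together with the ends that
agree with `e` up to the index `j`. -/
def endNhd {K : CompactExhaustion S} (e : SpaceEnd K) (j : ℕ) : Set (EndCompactification K) :=
  EndCompactification.point '' e.comp j ∪
    EndCompactification.atEnd '' {f | ∀ i ≤ j, f.comp i = e.comp i}

theorem endNhd_anti {K : CompactExhaustion S} (e : SpaceEnd K) {i j : ℕ} (h : i ≤ j) :
    endNhd e j ⊆ endNhd e i := by
  refine union_subset_union (image_mono ?_) (image_mono fun f hf k hk => hf k (hk.trans h))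
  exact antitone_nat_of_succ_le (f := e.comp) e.succ_subset h

/-- The topology of the end compactification: a set is open if with every point of `S` it
contains a neighbourhood of it in `S`, and with every end `e` some basic neighbourhood
`endNhd e j`. -/
instance (K : CompactExhaustion S) : TopologicalSpace (EndCompactification K) where
  IsOpen U := IsOpen {x | EndCompactification.point x ∈ U} ∧
    ∀ e : SpaceEnd K, EndCompactification.atEnd e ∈ U → ∃ j, endNhd e j ⊆ U
  isOpen_univ := ⟨by simp, fun _ _ => ⟨0, subset_univ _⟩⟩
  isOpen_inter := by
    rintro U V ⟨hU, hU'⟩ ⟨hV, hV'⟩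
    refine ⟨hU.inter hV, fun e he => ?_⟩
    obtain ⟨i, hi⟩ := hU' e he.1
    obtain ⟨j, hj⟩ := hV' e he.2
    exact ⟨max i j, subset_inter ((endNhd_anti e (le_max_left _ _)).trans hi)
      ((endNhd_anti e (le_max_right _ _)).trans hj)⟩
  isOpen_sUnion := by
    intro 𝒰 h𝒰
    refine ⟨?_, ?_⟩
    · have : {x | EndCompactification.point x ∈ ⋃₀ 𝒰} =
          ⋃ U ∈ 𝒰, {x : S | EndCompactification.point (K := K) x ∈ U} := by
        ext; simp
      rw [this]
      exact isOpen_biUnion fun U hU => (h𝒰 U hU).1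
    · rintro e ⟨U, hU, he⟩
      obtain ⟨j, hj⟩ := (h𝒰 U hU).2 e he
      exact ⟨j, hj.trans (subset_sUnion_of_mem hU)⟩

end EndCompactification

/-! ### Horospheres centered at boundary points of the end compactification -/

section Horospheres

variable {E : Type*} [NormedAddCommGroup E] [NormedSpace ℂ E]
  {X : Type*} [TopologicalSpace X] [ChartedSpace E X] {Ω : Set X}

/-- The inclusion of `Ω` into the end compactification of its closure. -/
def toEnd (hΩ : IsHyperbolicDomain E Ω) (K : CompactExhaustion (closure Ω))
    (z : KobayashiSpace hΩ) : EndCompactification K :=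
  .point ⟨z.val, subset_closure z.property⟩

/-- The boundary of the end compactification, i.e. the complement of `Ω` in it. -/
def endBoundary (hΩ : IsHyperbolicDomain E Ω) (K : CompactExhaustion (closure Ω)) :
    Set (EndCompactification K) :=
  univ \ range (toEnd hΩ K)

variable [IsManifold 𝓘(ℂ, E) 1 X]

/-- The big horosphere with center `x`, pole `p` and radius `R`. -/
noncomputable def bigHorosphere (hΩ : IsHyperbolicDomain E Ω)
    (K : CompactExhaustion (closure Ω)) (p : KobayashiSpace hΩ) (x : EndCompactification K)
    (R : ℝ) : Set (KobayashiSpace hΩ) :=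
  {z | liminf (fun w => ((dist z w - dist p w : ℝ) : EReal)) (comap (toEnd hΩ K) (𝓝 x)) <
    ((1 / 2 * Real.log R : ℝ) : EReal)}

/-- The small horosphere with center `x`, pole `p` and radius `R`. -/
noncomputable def smallHorosphere (hΩ : IsHyperbolicDomain E Ω)
    (K : CompactExhaustion (closure Ω)) (p : KobayashiSpace hΩ) (x : EndCompactification K)
    (R : ℝ) : Set (KobayashiSpace hΩ) :=
  {z | limsup (fun w => ((dist z w - dist p w : ℝ) : EReal)) (comap (toEnd hΩ K) (𝓝 x)) <
    ((1 / 2 * Real.log R : ℝ) : EReal)}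

/-- The metric boundary points that are limits of sequences in `Ω` converging to `x`. -/
def metricFiber (hΩ : IsHyperbolicDomain E Ω) (K : CompactExhaustion (closure Ω))
    (x : EndCompactification K) : Set (FunctionsModConstants (KobayashiSpace hΩ)) :=
  {ξ | ξ ∈ metricBoundary (KobayashiSpace hΩ) ∧ ∃ u : ℕ → KobayashiSpace hΩ,
    Tendsto (fun n => toEnd hΩ K (u n)) atTop (𝓝 x) ∧
    Tendsto (fun n => metricEmbedding (u n)) atTop (𝓝 ξ)}

end Horospheres

end Horospheres

open Horospheres

namespace Horospheres

/-! ### Geodesics of the Poincaré distance -/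

/-! If `u n → x` and `metricEmbedding (u n) → ξ`, then `dist z (u n) - dist p (u n)` tends to
`horofunction p ξ z`. Hence every value `horofunction p ξ z` with `ξ` in the fibre of `x` lies
between the liminf and the limsup that define the two horospheres (`liminf_le_horofunction`,
`horofunction_le_limsup`). This gives one inclusion in each equality.

The other inclusions need points of the fibre that realize these bounds. Take a sequence tending to
`x` with suitable values of `dist z · - dist p ·` and pass to a subsequence that converges to a
point of the fibre (`exists_subseq_mem_metricFiber`). Three facts are behind this.

(1) The end compactification is first countable, so sequences suffice. Components of the complement
of `K j` need not be open; sequential compactness leaves only finitely many of them outside a large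
compact set, and this makes the sets `endNhd e j` neighbourhoods of `e` (`endNhd_mem_nhds`).

(2) Distance functions normalized at a point are 1-Lipschitz, so Arzelà–Ascoli gives convergent
subsequences (`exists_subseq_tendsto_metricEmbedding`).

(3) The limit is not some `metricEmbedding y`: otherwise the sequence would converge to `y` itself
(`tendsto_of_tendsto_metricEmbedding`), against `x` being a boundary point. This uses that the
Kobayashi distance is a length distance (`KobayashiSpace.exists_dist_eq_dist_le`) inducing the
manifold topology (`KobayashiSpace.continuous_val`). Both come from cutting chains of discs at
points of hyperbolic geodesics. -/

/-- The involutive automorphism of the unit disc that exchanges `0` and `a`. -/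
noncomputable def discInvolution (a z : ℂ) : ℂ := (a - z) / (1 - (starRingEnd ℂ) a * z)

theorem one_sub_conj_mul_ne_zero {a z : ℂ} (ha : ‖a‖ < 1) (hz : ‖z‖ < 1) :
    1 - (starRingEnd ℂ) a * z ≠ 0 := by
  intro h
  have h1 : ‖(starRingEnd ℂ) a * z‖ = 1 := by rw [← sub_eq_zero.1 h, norm_one]
  rw [norm_mul, Complex.norm_conj] at h1
  nlinarith [norm_nonneg a, norm_nonneg z]

theorem one_sub_conj_mul_self_ne_zero {a : ℂ} (ha : ‖a‖ < 1) :
    1 - (starRingEnd ℂ) a * a ≠ 0 :=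
  one_sub_conj_mul_ne_zero ha ha

theorem discInvolution_zero (a : ℂ) : discInvolution a 0 = a := by simp [discInvolution]

theorem discInvolution_discInvolution {a z : ℂ} (ha : ‖a‖ < 1) (hz : ‖z‖ < 1) :
    discInvolution a (discInvolution a z) = z := by
  have h1 := one_sub_conj_mul_ne_zero ha hz
  have h2 := one_sub_conj_mul_self_ne_zero ha
  have e1 : a - discInvolution a z =
      z * (1 - (starRingEnd ℂ) a * a) / (1 - (starRingEnd ℂ) a * z) := by
    rw [discInvolution, eq_div_iff h1, sub_mul, div_mul_cancel₀ _ h1]; ring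
  have e2 : 1 - (starRingEnd ℂ) a * discInvolution a z =
      (1 - (starRingEnd ℂ) a * a) / (1 - (starRingEnd ℂ) a * z) := by
    rw [discInvolution, eq_div_iff h1, sub_mul, mul_assoc, div_mul_cancel₀ _ h1]; ring
  rw [discInvolution, e1, e2, div_div_div_cancel_right₀ h1, mul_div_cancel_right₀ _ h2]

theorem discInvolution_sub {a u w : ℂ} (ha : ‖a‖ < 1) (hu : ‖u‖ < 1) (hw : ‖w‖ < 1) :
    discInvolution a u - discInvolution a w = (1 - (starRingEnd ℂ) a * a) * (w - u) /
      ((1 - (starRingEnd ℂ) a * u) * (1 - (starRingEnd ℂ) a * w)) := by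
  have h1 := one_sub_conj_mul_ne_zero ha hu
  have h2 := one_sub_conj_mul_ne_zero ha hw
  rw [discInvolution, discInvolution, div_sub_div _ _ h1 h2]
  congr 1
  ring

theorem one_sub_conj_discInvolution_mul {a u w : ℂ} (ha : ‖a‖ < 1) (hu : ‖u‖ < 1)
    (hw : ‖w‖ < 1) :
    1 - (starRingEnd ℂ) (discInvolution a w) * discInvolution a u =
      (1 - (starRingEnd ℂ) a * a) * (1 - (starRingEnd ℂ) w * u) /
      ((1 - (starRingEnd ℂ) a * u) * (starRingEnd ℂ) (1 - (starRingEnd ℂ) a * w)) := by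
  have h1 := one_sub_conj_mul_ne_zero ha hu
  have h2 : (starRingEnd ℂ) (1 - (starRingEnd ℂ) a * w) ≠ 0 :=
    (map_ne_zero _).2 (one_sub_conj_mul_ne_zero ha hw)
  rw [discInvolution, discInvolution]
  rw [map_div₀, div_mul_div_comm, one_sub_div (mul_ne_zero h2 h1)]
  simp only [map_sub, map_one, map_mul, Complex.conj_conj]
  congr 1 <;> ring

theorem norm_discInvolution_lt_one {a z : ℂ} (ha : ‖a‖ < 1) (hz : ‖z‖ < 1) :
    ‖discInvolution a z‖ < 1 := by
  have key := one_sub_conj_discInvolution_mul ha hz hz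
  have h1 : 0 < ‖1 - (starRingEnd ℂ) a * z‖ := norm_pos_iff.2 (one_sub_conj_mul_ne_zero ha hz)
  simp only [Complex.conj_mul', Complex.mul_conj'] at key
  have key' : 1 - ‖discInvolution a z‖ ^ 2 =
      (1 - ‖a‖ ^ 2) * (1 - ‖z‖ ^ 2) / ‖1 - (starRingEnd ℂ) a * z‖ ^ 2 := by
    exact_mod_cast key
  have h2 : 0 < 1 - ‖discInvolution a z‖ ^ 2 := by
    rw [key']
    have := norm_nonneg a
    have := norm_nonneg z
    exact div_pos (mul_pos (by nlinarith) (by nlinarith)) (by positivity)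
  nlinarith [norm_nonneg (discInvolution a z)]

theorem poincareDist_discInvolution {a u w : ℂ} (ha : ‖a‖ < 1) (hu : ‖u‖ < 1) (hw : ‖w‖ < 1) :
    poincareDist (discInvolution a u) (discInvolution a w) = poincareDist u w := by
  have h0 := norm_ne_zero_iff.2 (one_sub_conj_mul_self_ne_zero ha)
  have h1 := norm_ne_zero_iff.2 (one_sub_conj_mul_ne_zero ha hu)
  have h2 := norm_ne_zero_iff.2 (one_sub_conj_mul_ne_zero ha hw)
  have h3 := norm_ne_zero_iff.2 (one_sub_conj_mul_ne_zero hw hu)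
  rw [poincareDist, poincareDist, discInvolution_sub ha hu hw,
    one_sub_conj_discInvolution_mul ha hu hw]
  congr 1
  simp only [norm_div, norm_mul, Complex.norm_conj, norm_sub_rev w u]
  field_simp

/-- The arguments of the two `artanh` are the pseudohyperbolic distances from `0` to `t * r` and
from `t * r` to `r`. In logarithmic form the quotients `(1 + v) / (1 - v)` multiply and the factors
`1 ± t * r` cancel. -/
theorem artanh_add_artanh_of_mem_segment {r t : ℝ} (hr0 : 0 ≤ r) (hr : r < 1) (ht0 : 0 ≤ t)
    (ht : t ≤ 1) :
    Real.artanh (t * r) + Real.artanh ((1 - t) * r / (1 - t * r ^ 2)) = Real.artanh r := by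
  have htr : t * r ≤ r := mul_le_of_le_one_left hr0 ht
  have htr0 : 0 ≤ t * r := mul_nonneg ht0 hr0
  have hd : 0 < 1 - t * r ^ 2 := by nlinarith
  have e1 : 1 + (1 - t) * r / (1 - t * r ^ 2) = (1 + r) * (1 - t * r) / (1 - t * r ^ 2) := by
    field_simp; ring
  have e2 : 1 - (1 - t) * r / (1 - t * r ^ 2) = (1 - r) * (1 + t * r) / (1 - t * r ^ 2) := by
    field_simp; ring
  have p1 : 0 < 1 - t * r := by linarith
  have p2 : 0 < 1 - r := by linarith
  have q1 : 0 < 1 + (1 - t) * r / (1 - t * r ^ 2) := by rw [e1]; positivity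
  have q2 : 0 < 1 - (1 - t) * r / (1 - t * r ^ 2) := by rw [e2]; positivity
  rw [Real.artanh_eq_half_log ⟨by linarith, by linarith⟩,
    Real.artanh_eq_half_log ⟨by linarith, by linarith⟩,
    Real.artanh_eq_half_log ⟨by linarith, by linarith⟩, ← mul_add,
    ← Real.log_mul (by positivity) (by positivity), e1, e2]
  congr 2
  field_simp

theorem poincareDist_zero_left (w : ℂ) : poincareDist 0 w = Real.artanh ‖w‖ := by
  simp [poincareDist]

theorem poincareDist_segment {w : ℂ} (hw : ‖w‖ < 1) {t : ℝ} (ht : t ∈ Icc (0 : ℝ) 1) :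
    poincareDist 0 (t * w) + poincareDist (t * w) w = poincareDist 0 w := by
  rw [poincareDist_zero_left, poincareDist_zero_left,
    ← artanh_add_artanh_of_mem_segment (norm_nonneg w) hw ht.1 ht.2, poincareDist]
  have hd : 0 < 1 - t * ‖w‖ ^ 2 := by nlinarith [norm_nonneg w, ht.1, ht.2]
  have e1 : (t : ℂ) * w - w = -(((1 - t : ℝ) : ℂ) * w) := by push_cast; ring
  have e2 : 1 - (starRingEnd ℂ) w * (t * w) = ((1 - t * ‖w‖ ^ 2 : ℝ) : ℂ) := by
    push_cast
    rw [← Complex.conj_mul']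
    ring
  rw [norm_div, e1, e2, norm_neg, norm_mul, norm_mul, Complex.norm_real, Complex.norm_real,
    Complex.norm_real, Real.norm_of_nonneg ht.1, Real.norm_of_nonneg (sub_nonneg.2 ht.2),
    Real.norm_of_nonneg hd.le]

/-- Two points of the disc are joined by a connected set along which the Poincaré distance is
additive. -/
theorem exists_isPreconnected_poincareDist_add {a b : ℂ} (ha : a ∈ Metric.ball (0 : ℂ) 1)
    (hb : b ∈ Metric.ball (0 : ℂ) 1) :
    ∃ S ⊆ Metric.ball (0 : ℂ) 1, IsPreconnected S ∧ a ∈ S ∧ b ∈ S ∧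
      ∀ c ∈ S, poincareDist a c + poincareDist c b = poincareDist a b := by
  rw [mem_ball_zero_iff] at ha hb
  set w := discInvolution a b
  have hw : ‖w‖ < 1 := norm_discInvolution_lt_one ha hb
  have hwb : discInvolution a w = b := discInvolution_discInvolution ha hb
  have htw : ∀ t ∈ Icc (0 : ℝ) 1, ‖(t : ℂ) * w‖ < 1 := fun t ht => by
    rw [norm_mul, Complex.norm_real, Real.norm_of_nonneg ht.1]
    nlinarith [norm_nonneg w, ht.1, ht.2]
  -- The geodesic from `a` to `b`: the involution carries the radius from `0` to `w` onto it and
  -- preserves the distance.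
  refine ⟨(fun t : ℝ => discInvolution a (t * w)) '' Icc 0 1, ?_, ?_, ?_, ?_, ?_⟩
  · rintro _ ⟨t, ht, rfl⟩
    exact mem_ball_zero_iff.2 (norm_discInvolution_lt_one ha (htw t ht))
  · refine isPreconnected_Icc.image _ ?_
    refine ContinuousOn.div (by fun_prop) (by fun_prop) fun t ht => ?_
    exact one_sub_conj_mul_ne_zero ha (htw t ht)
  · exact ⟨0, by simp, by simp [discInvolution_zero]⟩
  · exact ⟨1, by simp, by simp [hwb]⟩
  · rintro _ ⟨t, ht, rfl⟩
    have h0 : ‖(0 : ℂ)‖ < 1 := by simp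
    have h1 := poincareDist_discInvolution ha h0 (htw t ht)
    have h2 := poincareDist_discInvolution ha (htw t ht) hw
    have h3 := poincareDist_discInvolution ha h0 hw
    rw [discInvolution_zero] at h1 h3
    rw [hwb] at h2 h3
    simp only [h1, h2, h3, poincareDist_segment hw ht]

/-! ### Chains of discs -/

section Chains

variable {E : Type*} [NormedAddCommGroup E] [NormedSpace ℂ E]
  {X : Type*} [TopologicalSpace X] [ChartedSpace E X] {Ω : Set X}

theorem DiscChain.left_mem {z w : X} {L : ℝ} (h : DiscChain E Ω z w L) : z ∈ Ω := by
  cases h with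
  | nil _ hz => exact hz
  | cons f a b w L hf hmaps ha hb h => exact hmaps ha

theorem DiscChain.kobayashiDist_le {z w : X} {L : ℝ} (h : DiscChain E Ω z w L) :
    kobayashiDist E Ω z w ≤ L :=
  csInf_le (bddBelow_discChain _ _) h

theorem DiscChain.single {f : ℂ → X} {a b : ℂ}
    (hf : MDifferentiableOn 𝓘(ℂ, ℂ) 𝓘(ℂ, E) f (Metric.ball 0 1))
    (hmaps : MapsTo f (Metric.ball 0 1) Ω)
    (ha : a ∈ Metric.ball (0 : ℂ) 1) (hb : b ∈ Metric.ball (0 : ℂ) 1) :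
    DiscChain E Ω (f a) (f b) (poincareDist a b) := by
  simpa using DiscChain.cons f a b (f b) 0 hf hmaps ha hb (.nil _ (hmaps hb))

/-- A chain of discs carries a connected set that joins its end points and at each point of
which the chain can be split. -/
theorem DiscChain.exists_isPreconnected_split {z w : X} {L : ℝ} (h : DiscChain E Ω z w L) :
    ∃ C : Set X, IsPreconnected C ∧ z ∈ C ∧ w ∈ C ∧ ∀ q ∈ C, ∃ L₁ L₂,
      DiscChain E Ω z q L₁ ∧ DiscChain E Ω q w L₂ ∧ L₁ + L₂ = L := by
  induction h with
  | nil z hz =>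
    refine ⟨{z}, isPreconnected_singleton, rfl, rfl, ?_⟩
    rintro q rfl
    exact ⟨0, 0, .nil q hz, .nil q hz, add_zero 0⟩
  | cons f a b w L hf hmaps ha hb h ih =>
    obtain ⟨C, hC, hbC, hwC, hsplit⟩ := ih
    obtain ⟨S, hS, hSc, haS, hbS, hadd⟩ := exists_isPreconnected_poincareDist_add ha hb
    -- Prepend the image of the geodesic of the first disc. It meets `C` at `f b`, and additivity
    -- along `S` allows cutting inside this disc.
    refine ⟨f '' S ∪ C, ?_, Or.inl ⟨a, haS, rfl⟩, Or.inr hwC, ?_⟩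
    · exact IsPreconnected.union (f b) ⟨b, hbS, rfl⟩ hbC
        (hSc.image f (hf.continuousOn.mono hS)) hC
    · rintro q (⟨c, hc, rfl⟩ | hq)
      · exact ⟨_, _, .single hf hmaps ha (hS hc), .cons f c b w L hf hmaps (hS hc) hb h, by
          rw [← add_assoc, hadd c hc]⟩
      · obtain ⟨L₁, L₂, h₁, h₂, hL⟩ := hsplit q hq
        exact ⟨_, L₂, .cons f a b q L₁ hf hmaps ha hb h₁, h₂, by rw [add_assoc, hL]⟩

theorem eventually_kobayashiDist_lt [IsManifold 𝓘(ℂ, E) 1 X] (ho : IsOpen Ω) {x : X}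
    (hx : x ∈ Ω) {ε : ℝ} (hε : 0 < ε) : ∀ᶠ y in 𝓝 x, kobayashiDist E Ω x y < ε := by
  set φ := chartAt E x with hφ
  have hU : IsOpen (φ.target ∩ φ.symm ⁻¹' Ω) := φ.isOpen_inter_preimage_symm ho
  have hxU : φ x ∈ φ.target ∩ φ.symm ⁻¹' Ω := by
    refine ⟨mem_chart_target E x, ?_⟩
    rw [mem_preimage, φ.left_inv (mem_chart_source E x)]
    exact hx
  obtain ⟨r, hr, hball⟩ := Metric.isOpen_iff.1 hU _ hxU
  have ht1 : Real.tanh (ε / 2) < 1 := Real.tanh_lt_one _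
  have ht0 : 0 < Real.tanh (ε / 2) := by
    rw [Real.tanh_eq_sinh_div_cosh]
    exact div_pos (Real.sinh_pos_iff.2 (half_pos hε)) (Real.cosh_pos _)
  have ht : Real.artanh (Real.tanh (ε / 2)) = ε / 2 := Real.artanh_tanh _
  set t := Real.tanh (ε / 2)
  have h1 : ∀ᶠ y in 𝓝 x, y ∈ φ.source := φ.open_source.mem_nhds (mem_chart_source E x)
  have h2 : ∀ᶠ y in 𝓝 x, φ y ∈ Metric.ball (φ x) (t * r) :=
    (φ.continuousAt (mem_chart_source E x)).eventually
      (Metric.ball_mem_nhds _ (mul_pos ht0 hr))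
  filter_upwards [h1, h2] with y hy hy'
  -- The disc is scaled so that `y` sits at the parameter `t = tanh (ε / 2)`, at Poincaré distance
  -- `ε / 2` from the centre.
  let g : ℂ → E := fun ζ => φ x + ζ • ((t⁻¹ : ℂ) • (φ y - φ x))
  have hg : MapsTo g (Metric.ball 0 1) (φ.target ∩ φ.symm ⁻¹' Ω) := by
    intro ζ hζ
    refine hball ?_
    rw [mem_ball_iff_norm] at hy' ⊢
    rw [mem_ball_zero_iff] at hζ
    have h3 : ‖g ζ - φ x‖ = ‖ζ‖ * (t⁻¹ * ‖φ y - φ x‖) := by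
      simp [g, norm_smul, abs_of_pos ht0]
    have h4 : t⁻¹ * ‖φ y - φ x‖ < r := by
      rwa [inv_mul_lt_iff₀ ht0]
    rw [h3]
    have h5 : 0 ≤ t⁻¹ * ‖φ y - φ x‖ := by positivity
    nlinarith [norm_nonneg ζ]
  have hgd : MDifferentiableOn 𝓘(ℂ, ℂ) 𝓘(ℂ, E) g (Metric.ball 0 1) := by
    refine DifferentiableOn.mdifferentiableOn ?_
    fun_prop
  have hf : MDifferentiableOn 𝓘(ℂ, ℂ) 𝓘(ℂ, E) (φ.symm ∘ g) (Metric.ball 0 1) :=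
    (mdifferentiableOn_atlas_symm (chart_mem_atlas E x)).comp hgd fun ζ hζ => (hg hζ).1
  have hfm : MapsTo (φ.symm ∘ g) (Metric.ball 0 1) Ω := fun ζ hζ => (hg hζ).2
  have hmem0 : (0 : ℂ) ∈ Metric.ball (0 : ℂ) 1 := by simp
  have hmemt : (t : ℂ) ∈ Metric.ball (0 : ℂ) 1 := by
    rw [mem_ball_zero_iff, Complex.norm_real, Real.norm_of_nonneg ht0.le]
    exact ht1
  have e0 : (φ.symm ∘ g) 0 = x := by
    simp only [g, Function.comp, zero_smul, add_zero]
    exact φ.left_inv (mem_chart_source E x)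
  have e1 : (φ.symm ∘ g) t = y := by
    have : g t = φ y := by
      have h6 : (t : ℂ) * (t : ℂ)⁻¹ = 1 := mul_inv_cancel₀ (by exact_mod_cast ht0.ne')
      simp only [g, smul_smul, h6, one_smul, add_sub_cancel]
    simp only [Function.comp, this]
    exact φ.left_inv hy
  have h := (DiscChain.single hf hfm hmem0 hmemt).kobayashiDist_le
  rw [e0, e1, poincareDist_zero_left, Complex.norm_real, Real.norm_of_nonneg ht0.le, ht] at h
  linarith

end Chains

/-- Otherwise the disjoint open sets `V` and `(closure V)ᶜ` would separate `C`. -/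
theorem _root_.IsPreconnected.inter_frontier_nonempty_of_isOpen {X : Type*} [TopologicalSpace X]
    {C V : Set X} (hC : IsPreconnected C) (hV : IsOpen V) (h₁ : (C ∩ V).Nonempty)
    (h₂ : (C ∩ Vᶜ).Nonempty) : (C ∩ frontier V).Nonempty := by
  by_contra! h
  have hfr : ∀ q ∈ C, q ∉ V → q ∉ closure V := fun q hq hqV hqc =>
    (h ▸ ⟨hq, hqc, by rwa [hV.interior_eq]⟩ : q ∈ (∅ : Set X))
  obtain ⟨w, hw, hwV⟩ := h₂
  obtain ⟨q, -, hqV, hq⟩ := hC V (closure V)ᶜ hV isClosed_closure.isOpen_compl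
    (fun q hq => or_iff_not_imp_left.2 (hfr q hq)) h₁ ⟨w, hw, hfr w hw hwV⟩
  exact hq (subset_closure hqV)

/-! ### The Kobayashi topology of a hyperbolic domain -/

section KobayashiTopology

variable {E : Type*} [NormedAddCommGroup E] [NormedSpace ℂ E]
  {X : Type*} [TopologicalSpace X] [ChartedSpace E X] [IsManifold 𝓘(ℂ, E) 1 X] {Ω : Set X}

theorem KobayashiSpace.dist_def {hΩ : IsHyperbolicDomain E Ω} (z w : KobayashiSpace hΩ) :
    dist z w = kobayashiDist E Ω z.val w.val := rfl

/-- The points of `Ω` as points of the Kobayashi space. -/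
def toKobayashiSpace (hΩ : IsHyperbolicDomain E Ω) (z : Ω) : KobayashiSpace hΩ := ⟨z.1, z.2⟩

theorem continuous_toKobayashiSpace (hΩ : IsHyperbolicDomain E Ω) :
    Continuous (toKobayashiSpace hΩ) := by
  refine continuous_iff_continuousAt.2 fun x => Metric.tendsto_nhds.2 fun ε hε => ?_
  have h := eventually_kobayashiDist_lt (E := E) hΩ.isOpen x.2 hε
  filter_upwards [continuous_subtype_val.continuousAt.eventually h] with y hy
  rwa [dist_comm]

theorem KobayashiSpace.exists_discChain_lt {hΩ : IsHyperbolicDomain E Ω}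
    {z w : KobayashiSpace hΩ} {r : ℝ} (h : dist z w < r) :
    ∃ L < r, DiscChain E Ω z.val w.val L := by
  obtain ⟨L, hL, hL'⟩ := exists_lt_of_csInf_lt
    (exists_discChain (E := E) hΩ.isOpen hΩ.isConnected z.property w.property) h
  exact ⟨L, hL', hL⟩

/-- The Kobayashi distance is a length distance: along almost minimizing chains one finds points
at prescribed distance from the first end point. -/
theorem KobayashiSpace.exists_dist_eq_dist_le {hΩ : IsHyperbolicDomain E Ω}
    (z w : KobayashiSpace hΩ) {r ε : ℝ} (hr : 0 ≤ r) (hrw : r ≤ dist z w) (hε : 0 < ε) :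
    ∃ s, dist z s = r ∧ dist s w ≤ dist z w - r + ε := by
  obtain ⟨L, hL, hchain⟩ := exists_discChain_lt (lt_add_of_pos_right (dist z w) hε)
  obtain ⟨C, hC, hzC, hwC, hsplit⟩ := hchain.exists_isPreconnected_split
  have hCΩ : C ⊆ Ω := fun q hq => by
    obtain ⟨_, _, _, h, _⟩ := hsplit q hq
    exact h.left_mem
  have hcont : ContinuousOn (fun q => kobayashiDist E Ω z.val q) Ω := by
    rw [continuousOn_iff_continuous_domRestrict]
    exact (continuous_const (y := z)).dist (continuous_toKobayashiSpace hΩ)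
  -- The distance from `z` is continuous on the connected set carried by the chain, so it takes the
  -- value `r` at some `q`. The part of the chain before `q` has length at least `r`, which bounds
  -- the rest.
  obtain ⟨q, hq, hqr⟩ := hC.intermediate_value hzC hwC (hcont.mono hCΩ)
    (show r ∈ Icc _ _ from ⟨(dist_self z).trans_le hr, hrw⟩)
  obtain ⟨L₁, L₂, h₁, h₂, hsum⟩ := hsplit q hq
  refine ⟨⟨q, hCΩ hq⟩, hqr, ?_⟩
  have h3 := h₁.kobayashiDist_le
  have h4 := h₂.kobayashiDist_le
  simp only at hqr
  rw [KobayashiSpace.dist_def ⟨q, hCΩ hq⟩ w]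
  linarith

variable [FiniteDimensional ℂ E] [T2Space X]

/-- The Kobayashi distance of a hyperbolic domain induces the topology of the manifold. -/
theorem KobayashiSpace.continuous_val (hΩ : IsHyperbolicDomain E Ω) :
    Continuous (KobayashiSpace.val : KobayashiSpace hΩ → X) := by
  have : LocallyCompactSpace E := have := FiniteDimensional.proper ℂ E; inferInstance
  have : LocallyCompactSpace X := ChartedSpace.locallyCompactSpace E X
  refine continuous_iff_continuousAt.2 fun y => ?_
  refine fun U hU => ?_
  obtain ⟨V, hVo, hyV, hVU, hVc⟩ := exists_open_between_and_isCompact_closure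
    (isCompact_singleton (x := y.val)) (isOpen_interior.inter hΩ.isOpen)
    (singleton_subset_iff.2 ⟨mem_interior_iff_mem_nhds.2 hU, y.property⟩)
  rw [singleton_subset_iff] at hyV
  have hfr : frontier V ⊆ Ω := frontier_subset_closure.trans (hVU.trans inter_subset_right)
  -- The frontier is compact also for the Kobayashi distance, hence closed there. As it misses `y`,
  -- it stays at positive distance `δ` from `y`.
  have hT : IsCompact (toKobayashiSpace hΩ '' (Subtype.val ⁻¹' frontier V)) := by
    refine IsCompact.image ?_ (continuous_toKobayashiSpace hΩ)
    rw [Subtype.isCompact_iff, Subtype.image_preimage_coe, inter_eq_right.2 hfr]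
    exact hVc.of_isClosed_subset isClosed_frontier frontier_subset_closure
  have hyT : y ∉ toKobayashiSpace hΩ '' (Subtype.val ⁻¹' frontier V) := by
    rintro ⟨q, hq, rfl⟩
    exact (hVo.inter_frontier_eq ▸ (⟨hyV, hq⟩ : q.1 ∈ V ∩ frontier V) : q.1 ∈ (∅ : Set X))
  obtain ⟨δ, hδ, hball⟩ := Metric.isOpen_iff.1 hT.isClosed.isOpen_compl y hyT
  refine Filter.mem_map.2 (Filter.mem_of_superset (Metric.ball_mem_nhds y hδ) fun w hw => ?_)
  by_contra hwU
  have hwV : w.val ∉ V := fun h => hwU (interior_subset (s := U) (hVU (subset_closure h)).1)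
  obtain ⟨L, hL, hchain⟩ := exists_discChain_lt (Metric.mem_ball'.1 hw)
  obtain ⟨C, hC, hyC, hwC, hsplit⟩ := hchain.exists_isPreconnected_split
  -- A chain shorter than `δ` that leaves `V` must cross the frontier, at a point too close to `y`.
  obtain ⟨q, hqC, hqV⟩ := hC.inter_frontier_nonempty_of_isOpen hVo ⟨_, hyC, hyV⟩ ⟨_, hwC, hwV⟩
  obtain ⟨L₁, L₂, h₁, h₂, hsum⟩ := hsplit q hqC
  refine hball (a := ⟨q, hfr hqV⟩) ?_ ⟨⟨q, hfr hqV⟩, hqV, rfl⟩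
  rw [Metric.mem_ball', KobayashiSpace.dist_def]
  have h3 := h₁.kobayashiDist_le
  have h4 := h₂.nonneg
  simp only at h3 ⊢
  linarith

/-- A hyperbolic domain with the topology of the manifold is homeomorphic to its Kobayashi
space. -/
def kobayashiHomeomorph (hΩ : IsHyperbolicDomain E Ω) : Ω ≃ₜ KobayashiSpace hΩ where
  toFun := toKobayashiSpace hΩ
  invFun z := ⟨z.val, z.property⟩
  left_inv _ := rfl
  right_inv _ := rfl
  continuous_toFun := continuous_toKobayashiSpace hΩ
  continuous_invFun := (KobayashiSpace.continuous_val hΩ).subtype_mk _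

theorem KobayashiSpace.locallyCompactSpace (hΩ : IsHyperbolicDomain E Ω) :
    LocallyCompactSpace (KobayashiSpace hΩ) := by
  have : LocallyCompactSpace E := have := FiniteDimensional.proper ℂ E; inferInstance
  have : LocallyCompactSpace X := ChartedSpace.locallyCompactSpace E X
  have : LocallyCompactSpace Ω := hΩ.isOpen.locallyCompactSpace
  exact (kobayashiHomeomorph hΩ).symm.isClosedEmbedding.locallyCompactSpace

theorem KobayashiSpace.secondCountableTopology [SecondCountableTopology X]
    (hΩ : IsHyperbolicDomain E Ω) : SecondCountableTopology (KobayashiSpace hΩ) :=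
  (kobayashiHomeomorph hΩ).symm.isEmbedding.secondCountableTopology

end KobayashiTopology

end Horospheres

namespace Horospheres

/-! ### The topology of the end compactification -/

section EndTopology

variable {S : Type*} [TopologicalSpace S]

theorem exists_isClosed_inter_eq_connectedComponentIn (U : Set S) (x : S) :
    ∃ F, IsClosed F ∧ F ∩ U = connectedComponentIn U x := by
  by_cases hx : x ∈ U
  -- The trace on `U` of the closure of a component is still preconnected, so it adds nothing to the
  -- component.
  · refine ⟨closure (connectedComponentIn U x), isClosed_closure, subset_antisymm ?_
      (subset_inter subset_closure (connectedComponentIn_subset U x))⟩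
    refine IsPreconnected.subset_connectedComponentIn ?_
      ⟨subset_closure (mem_connectedComponentIn hx), hx⟩ inter_subset_right
    exact isPreconnected_connectedComponentIn.subset_closure
      (subset_inter subset_closure (connectedComponentIn_subset U x)) inter_subset_left
  · exact ⟨∅, isClosed_empty, by rw [empty_inter, connectedComponentIn_eq_empty hx]⟩

variable {K : CompactExhaustion S}

namespace SpaceEnd

theorem comp_anti (e : SpaceEnd K) : Antitone e.comp :=
  antitone_nat_of_succ_le e.succ_subset

theorem comp_subset_compl (e : SpaceEnd K) (j : ℕ) : e.comp j ⊆ (K j)ᶜ := by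
  obtain ⟨x, -, hx⟩ := e.isComponent j
  exact hx ▸ connectedComponentIn_subset _ _

theorem connectedComponentIn_eq_comp (e : SpaceEnd K) {j : ℕ} {y : S} (hy : y ∈ e.comp j) :
    connectedComponentIn (K j)ᶜ y = e.comp j := by
  obtain ⟨x, -, hx⟩ := e.isComponent j
  rw [hx] at hy ⊢
  exact (connectedComponentIn_eq hy).symm

end SpaceEnd

theorem isOpenEmbedding_point (K : CompactExhaustion S) :
    IsOpenEmbedding (EndCompactification.point : S → EndCompactification K) := by
  refine .of_continuous_injective_isOpenMap
    (continuous_def.2 fun U hU => hU.1) (fun x y h => by injection h) fun U hU => ⟨?_, ?_⟩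
  · convert hU using 1
    ext x
    constructor
    · rintro ⟨y, hy, h⟩
      injection h with h
      exact h ▸ hy
    · exact mem_image_of_mem _
  · rintro e ⟨y, -, h⟩
    cases h

theorem eq_point_of_tendsto [T2Space S] {ι : Type*} {l : Filter ι} [l.NeBot] {u : ι → S}
    {x : EndCompactification K} {y : S}
    (hx : Tendsto (fun n => EndCompactification.point (u n)) l (𝓝 x)) (hy : Tendsto u l (𝓝 y)) :
    x = .point y := by
  cases x with
  | point z => rw [tendsto_nhds_unique ((isOpenEmbedding_point K).tendsto_nhds_iff.2 hx) hy]
  | atEnd e =>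
    -- A point and an end are separated: some `K i` is a neighbourhood of the point, and its
    -- complement is an open set containing all the ends.
    obtain ⟨i, hi⟩ := K.exists_mem_nhds y
    have hU : IsOpen (EndCompactification.point '' K i : Set (EndCompactification K))ᶜ := by
      refine ⟨?_, fun g _ => ⟨i, ?_⟩⟩
      · convert (K.isCompact i).isClosed.isOpen_compl using 1
        ext x
        exact not_congr (isOpenEmbedding_point K).injective.mem_set_image
      · rintro _ (⟨x, hx, rfl⟩ | ⟨g', -, rfl⟩)
        · rw [mem_compl_iff, (isOpenEmbedding_point K).injective.mem_set_image]
          exact g.comp_subset_compl i hx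
        · rintro ⟨_, _, h⟩
          cases h
    have heU : EndCompactification.atEnd e ∈
        (EndCompactification.point '' K i : Set (EndCompactification K))ᶜ := by
      rintro ⟨_, _, h⟩
      cases h
    obtain ⟨n, hn, hn'⟩ := ((hy.eventually hi).and (hx.eventually (hU.mem_nhds heU))).exists
    exact absurd (mem_image_of_mem _ hn) hn'

/-- In a sequentially compact end compactification a sequence that leaves every compact set has
two terms in the same component of the complement of `K j`. -/
theorem exists_connectedComponentIn_eq [T1Space S] [SeqCompactSpace (EndCompactification K)]
    (j : ℕ) (f : ℕ → S) (hf : StrictMono fun n => K.find (f n)) :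
    ∃ m n, m < n ∧ connectedComponentIn (K j)ᶜ (f m) = connectedComponentIn (K j)ᶜ (f n) := by
  by_contra! hne
  have hcomp : ∀ n, ∀ i, f n ∈ K i → n ≤ i := fun n i h =>
    (hf.id_le n).trans (K.mem_iff_find_le.1 h)
  have hclosed : IsClosed (range f) := by
    rw [← iUnion_singleton_eq_range]
    refine LocallyFinite.isClosed_iUnion (fun x => ?_) fun n => isClosed_singleton
    obtain ⟨i, hi⟩ := K.exists_mem_nhds x
    refine ⟨K i, hi, (finite_Iic i).subset ?_⟩
    rintro n ⟨_, rfl, hn⟩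
    exact hcomp n i hn
  obtain ⟨a, φ, hφ, ha⟩ := SeqCompactSpace.tendsto_subseq
    (fun n => (EndCompactification.point (f n) : EndCompactification K))
  cases a with
  | point y =>
    obtain ⟨i, hi⟩ := K.exists_mem_nhds y
    have h1 : Tendsto (fun n => f (φ n)) atTop (𝓝 y) :=
      (isOpenEmbedding_point K).tendsto_nhds_iff.2 ha
    obtain ⟨n, hn, hni⟩ := ((h1.eventually hi).and (eventually_gt_atTop i)).exists
    exact absurd (hcomp _ _ hn) (not_le.2 (hni.trans_le (hφ.id_le n)))
  | atEnd e =>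
    -- The aim is that the complement of the sequence is an open set containing all ends, so that no
    -- subsequence can converge to an end.
    let U : Set (EndCompactification K) := (EndCompactification.point '' range f)ᶜ
    have hU : IsOpen U := by
      refine ⟨?_, fun g _ => ?_⟩
      · have : {x | (EndCompactification.point x : EndCompactification K) ∈ U} = (range f)ᶜ := by
          ext x
          exact not_congr ((isOpenEmbedding_point K).injective.mem_set_image)
        rw [this]
        exact hclosed.isOpen_compl
      · have hdisj : ∃ i, ∀ n, f n ∉ g.comp i := by
          by_cases h : ∃ m, f m ∈ g.comp j
          · obtain ⟨m, hm⟩ := h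
            -- By `hne` the component at level `j` contains no term other than `f m`, and going
            -- beyond `K.find (f m)` discards `f m` too.
            refine ⟨max j (K.find (f m)), fun n hn => ?_⟩
            have hnj := g.comp_anti (le_max_left _ _) hn
            have hmn : m = n := by
              have heq := (g.connectedComponentIn_eq_comp hm).trans
                (g.connectedComponentIn_eq_comp hnj).symm
              rcases lt_trichotomy m n with h | h | h
              · exact absurd heq (hne m n h)
              · exact h
              · exact absurd heq.symm (hne n m h)
            subst hmn
            exact g.comp_subset_compl _ (g.comp_anti (le_max_right _ _) hn) (K.mem_find _)
          · push Not at h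
            exact ⟨j, h⟩
        obtain ⟨i, hi⟩ := hdisj
        refine ⟨i, ?_⟩
        rintro _ (⟨x, hx, rfl⟩ | ⟨g', -, rfl⟩)
        · rintro ⟨_, ⟨n, rfl⟩, h⟩
          injection h with h
          exact hi n (h ▸ hx)
        · rintro ⟨_, _, h⟩
          cases h
    have heU : EndCompactification.atEnd e ∈ U := by
      rintro ⟨_, _, h⟩
      cases h
    obtain ⟨n, hn⟩ := (ha.eventually (hU.mem_nhds heU)).exists
    exact hn ⟨_, ⟨_, rfl⟩, rfl⟩

/-- In a sequentially compact end compactification only finitely many components of the complement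
of `K j` are not contained in some large `K m`. -/
theorem exists_finite_components [T1Space S] [SeqCompactSpace (EndCompactification K)] (j : ℕ) :
    ∃ m, j ≤ m ∧ (connectedComponentIn (K j)ᶜ '' (K m)ᶜ).Finite := by
  by_contra! hinf
  obtain ⟨f, -, hf⟩ := exists_seq_of_forall_finset_exists (fun _ : S => True)
    (fun x y => K.find x < K.find y ∧
      connectedComponentIn (K j)ᶜ x ≠ connectedComponentIn (K j)ᶜ y) (fun s _ => by
    classical
    obtain ⟨_, ⟨y, hy, rfl⟩, hys⟩ := (hinf (max j (s.sup K.find))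
      (le_max_left _ _)).exists_notMem_finset (s.image (connectedComponentIn (K j)ᶜ))
    refine ⟨y, trivial, fun x hx => ⟨?_, fun h => hys (h ▸ Finset.mem_image_of_mem _ hx)⟩⟩
    rw [mem_compl_iff, K.mem_iff_find_le, not_le] at hy
    exact ((Finset.le_sup hx).trans (le_max_right _ _)).trans_lt hy)
  obtain ⟨m, n, hmn, h⟩ := exists_connectedComponentIn_eq j f fun m n h => (hf m n h).1
  exact (hf m n hmn).2 h

theorem endNhd_mem_nhds [T2Space S] [SeqCompactSpace (EndCompactification K)]
    (e : SpaceEnd K) (j : ℕ) : endNhd e j ∈ 𝓝 (EndCompactification.atEnd e) := by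
  obtain ⟨m, hjm, hfin⟩ := exists_finite_components (K := K) j
  choose F hF hFeq using exists_isClosed_inter_eq_connectedComponentIn (K j)ᶜ
  set 𝒞 := connectedComponentIn (K j)ᶜ '' (K m)ᶜ \ {e.comp j} with h𝒞
  have h𝒞fin : 𝒞.Finite := hfin.subset sdiff_subset
  have hsub : (K m)ᶜ ⊆ (K j)ᶜ := compl_subset_compl.2 (K.subset hjm)
  have hopen : IsOpen ((K m)ᶜ ∩ e.comp j) := by
    -- Outside `K m` the component is what remains after removing finitely many other components.
    -- These are relatively closed in `(K j)ᶜ`, so their closures do not meet `e.comp j`.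
    have heq : (K m)ᶜ ∩ e.comp j = (K m)ᶜ ∩ ⋂ C ∈ 𝒞, (closure C)ᶜ := by
      ext y
      refine and_congr_right fun hy => ?_
      simp only [mem_iInter]
      constructor
      · rintro hye C ⟨⟨x, hx, rfl⟩, hxe⟩ hyC
        have hyF : y ∈ F x ∩ (K j)ᶜ :=
          ⟨closure_minimal ((hFeq x).symm.subset.trans inter_subset_left) (hF x) hyC, hsub hy⟩
        rw [hFeq] at hyF
        exact hxe ((connectedComponentIn_eq hyF).trans (e.connectedComponentIn_eq_comp hye))
      · intro h
        by_contra hye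
        refine h (connectedComponentIn (K j)ᶜ y) ⟨⟨y, hy, rfl⟩, fun h' => hye ?_⟩
          (subset_closure (mem_connectedComponentIn (hsub hy)))
        rw [← mem_singleton_iff.1 h']
        exact mem_connectedComponentIn (hsub hy)
    rw [heq]
    exact (K.isCompact m).isClosed.isOpen_compl.inter
      (h𝒞fin.isOpen_biInter fun C _ => isClosed_closure.isOpen_compl)
  let V : Set (EndCompactification K) := EndCompactification.point '' ((K m)ᶜ ∩ e.comp j) ∪
    EndCompactification.atEnd '' {f | ∀ i ≤ j, f.comp i = e.comp i}
  have hV : IsOpen V := by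
    refine ⟨?_, ?_⟩
    · convert hopen using 1
      ext x
      constructor
      · rintro (⟨y, hy, h⟩ | ⟨_, _, h⟩)
        · injection h with h
          exact h ▸ hy
        · cases h
      · exact fun hx => Or.inl ⟨x, hx, rfl⟩
    · rintro f (⟨_, _, h⟩ | ⟨f', hf', h⟩)
      · cases h
      · injection h with h
        subst h
        refine ⟨m, union_subset_union (image_mono (subset_inter (f'.comp_subset_compl m) ?_))
          (image_mono fun g hg i hi => (hg i (hi.trans hjm)).trans (hf' i hi))⟩
        exact (f'.comp_anti hjm).trans (hf' j le_rfl).subset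
  exact mem_of_superset (hV.mem_nhds (Or.inr ⟨e, fun _ _ => rfl, rfl⟩))
    (union_subset_union_left _ (image_mono inter_subset_right))

theorem hasBasis_nhds_atEnd [T2Space S] [SeqCompactSpace (EndCompactification K)]
    (e : SpaceEnd K) :
    (𝓝 (EndCompactification.atEnd e)).HasBasis (fun _ : ℕ => True) (endNhd e) := by
  refine ⟨fun s => ⟨fun hs => ?_, ?_⟩⟩
  · obtain ⟨U, hUs, hU, heU⟩ := mem_nhds_iff.1 hs
    obtain ⟨j, hj⟩ := hU.2 e heU
    exact ⟨j, trivial, hj.trans hUs⟩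
  · rintro ⟨j, -, hj⟩
    exact mem_of_superset (endNhd_mem_nhds e j) hj

theorem firstCountableTopology_endCompactification [T2Space S] [FirstCountableTopology S]
    [SeqCompactSpace (EndCompactification K)] :
    FirstCountableTopology (EndCompactification K) := by
  refine ⟨fun x => ?_⟩
  cases x with
  | point y =>
    rw [← (isOpenEmbedding_point K).map_nhds_eq]
    infer_instance
  | atEnd e => exact (hasBasis_nhds_atEnd e).isCountablyGenerated

end EndTopology

end Horospheres

namespace Horospheres

/-! ### Functions modulo constants -/

section HoroFunctions

variable {Y : Type*} [MetricSpace Y]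

theorem horofunction_mk (p : Y) (f : C(Y, ℝ)) (z : Y) :
    horofunction p (QuotientAddGroup.mk f) z = f z - f p := rfl

theorem horofunction_metricEmbedding (p y z : Y) :
    horofunction p (metricEmbedding y) z = dist y z - dist y p := rfl

/-- Normalizing at `p` is continuous on `C(Y, ℝ)` and kills constants. Thus convergence in the
quotient yields convergence of the normalized representatives. -/
theorem continuous_horofunction (p : Y) : Continuous (horofunction p : _ → C(Y, ℝ)) := by
  refine (QuotientAddGroup.isQuotientMap_mk (constantFunctions Y)).continuous_iff.2 ?_
  have h : Continuous fun c : ℝ => ContinuousMap.const Y c := ContinuousMap.continuous_const'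
  exact continuous_id.sub (h.comp (continuous_eval_const p))

theorem mk_horofunction (p : Y) (ξ : FunctionsModConstants Y) :
    (QuotientAddGroup.mk (horofunction p ξ) : FunctionsModConstants Y) = ξ := by
  induction ξ using QuotientAddGroup.induction_on with
  | H f =>
    refine QuotientAddGroup.eq.2 ⟨f p, ?_⟩
    ext z
    simp [horofunction_mk]

theorem tendsto_horofunction_apply (p z : Y) {ι : Type*} {l : Filter ι} {u : ι → Y}
    {ξ : FunctionsModConstants Y} (h : Tendsto (fun n => metricEmbedding (u n)) l (𝓝 ξ)) :
    Tendsto (fun n => dist z (u n) - dist p (u n)) l (𝓝 (horofunction p ξ z)) := by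
  have h1 := ((continuous_eval_const z).tendsto _).comp
    (((continuous_horofunction p).tendsto ξ).comp h)
  refine h1.congr fun n => ?_
  simp only [Function.comp, horofunction_metricEmbedding, dist_comm]

/-- In a locally compact space with approximate geodesics the map `metricEmbedding` is an
embedding. -/
theorem tendsto_of_tendsto_metricEmbedding [LocallyCompactSpace Y]
    (hlen : ∀ (z w : Y) (r ε : ℝ), 0 ≤ r → r ≤ dist z w → 0 < ε →
      ∃ s, dist z s = r ∧ dist s w ≤ dist z w - r + ε)
    {ι : Type*} {l : Filter ι} {u : ι → Y} {y : Y}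
    (h : Tendsto (fun n => metricEmbedding (u n)) l (𝓝 (metricEmbedding y))) :
    Tendsto u l (𝓝 y) := by
  obtain ⟨C, hC, hCy⟩ := exists_compact_mem_nhds y
  obtain ⟨ρ, hρ, hball⟩ := Metric.nhds_basis_closedBall.mem_iff.1 hCy
  have hcomp := hC.of_isClosed_subset Metric.isClosed_closedBall hball
  refine Metric.tendsto_nhds.2 fun ε hε => ?_
  set r := min ρ (ε / 2)
  have hr : 0 < r := lt_min hρ (half_pos hε)
  have h1 := ContinuousMap.tendsto_iff_forall_isCompact_tendstoUniformlyOn.1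
    (((continuous_horofunction y).tendsto _).comp h) _ hcomp
  filter_upwards [Metric.tendstoUniformlyOn_iff.1 h1 r hr] with n hn
  by_contra hlt
  have hle : r ≤ dist y (u n) := by
    rw [dist_comm]
    linarith [min_le_right ρ (ε / 2)]
  -- At a point `s` at distance `r` from `y`, almost on the way to `u n`, the function of `u n`
  -- normalized at `y` is at most `-r / 2`. That of `y` equals `r`, so the two are not `r`-close.
  obtain ⟨s, hs, hs'⟩ := hlen y (u n) r (r / 2) hr.le hle (half_pos hr)
  have h2 := hn s (by
    rw [Metric.mem_closedBall', hs]
    exact min_le_left _ _)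
  simp only [Function.comp, horofunction_metricEmbedding, dist_self, Real.dist_eq] at h2
  rw [hs, dist_comm (u n) s, dist_comm (u n) y] at h2
  linarith [(abs_lt.1 h2).2]

/-- Arzelà–Ascoli: the Lipschitz bound gives equicontinuity and, with the value at `p` fixed,
confines the values at `x` to a ball of radius `dist x p`. -/
theorem isCompact_lipschitz_vanishing (p : Y) :
    IsCompact {f : C(Y, ℝ) | LipschitzWith 1 f ∧ f p = 0} := by
  refine ArzelaAscoli.isCompact_of_equicontinuous _ ?_ ?_
  · have himage : ContinuousMap.toFun '' {f : C(Y, ℝ) | LipschitzWith 1 f ∧ f p = 0} =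
        {f : Y → ℝ | (∀ x y, dist (f x) (f y) ≤ dist x y) ∧ f p = 0} := by
      ext f
      constructor
      · rintro ⟨f, ⟨hf, hfp⟩, rfl⟩
        exact ⟨fun x y => by simpa using hf.dist_le_mul x y, hfp⟩
      · rintro ⟨hf, hfp⟩
        have hL : LipschitzWith 1 f := LipschitzWith.of_dist_le_mul (by simpa using hf)
        exact ⟨⟨f, hL.continuous⟩, ⟨hL, hfp⟩, rfl⟩
    rw [himage]
    refine (isCompact_univ_pi fun x => isCompact_closedBall (0 : ℝ) (dist x p)).of_isClosed_subset
      ?_ ?_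
    · simp only [ofPred_and, ofPred_forall]
      refine (isClosed_iInter fun x => isClosed_iInter fun y => ?_).inter ?_
      · exact isClosed_le (by fun_prop) continuous_const
      · exact isClosed_eq (by fun_prop) continuous_const
    · rintro f ⟨hf, hfp⟩ x -
      simpa [hfp] using hf x p
  · exact LipschitzWith.uniformEquicontinuous _ 1 (fun f => f.2.1) |>.equicontinuous

theorem lipschitzWith_horofunction_metricEmbedding (p y : Y) :
    LipschitzWith 1 (horofunction p (metricEmbedding y)) := by
  refine LipschitzWith.of_dist_le_mul fun a b => ?_
  simp only [horofunction_metricEmbedding, NNReal.coe_one, one_mul, dist_sub_right]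
  exact dist_dist_dist_le_right y a b

theorem exists_subseq_tendsto_metricEmbedding [LocallyCompactSpace Y] [SigmaCompactSpace Y]
    (p : Y) (u : ℕ → Y) : ∃ ξ ∈ metricCompactification Y, ∃ φ : ℕ → ℕ, StrictMono φ ∧
      Tendsto (fun n => metricEmbedding (u (φ n))) atTop (𝓝 ξ) := by
  obtain ⟨h, -, φ, hφ, hlim⟩ := (isCompact_lipschitz_vanishing p).tendsto_subseq
    (x := fun n => horofunction p (metricEmbedding (u n)))
    fun n => ⟨lipschitzWith_horofunction_metricEmbedding p _, sub_self _⟩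
  have hlim' : Tendsto (fun n => metricEmbedding (u (φ n))) atTop
      (𝓝 (QuotientAddGroup.mk h : FunctionsModConstants Y)) := by
    refine ((QuotientAddGroup.continuous_mk.tendsto h).comp hlim).congr fun n => ?_
    exact mk_horofunction p _
  exact ⟨_, mem_closure_of_tendsto hlim' (.of_forall fun n => mem_range_self _), φ, hφ, hlim'⟩

end HoroFunctions

/-! ### Horospheres -/

section HorosphereDescription

variable {E : Type*} [NormedAddCommGroup E] [NormedSpace ℂ E]
  {X : Type*} [TopologicalSpace X] [ChartedSpace E X] [IsManifold 𝓘(ℂ, E) 1 X] {Ω : Set X}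
  {hΩ : IsHyperbolicDomain E Ω} {K : CompactExhaustion (closure Ω)}

theorem tendsto_coe_of_mem_metricFiber {ξ : FunctionsModConstants (KobayashiSpace hΩ)}
    {u : ℕ → KobayashiSpace hΩ} (h : Tendsto (fun n => metricEmbedding (u n)) atTop (𝓝 ξ))
    (p z : KobayashiSpace hΩ) :
    Tendsto (fun n => ((dist z (u n) - dist p (u n) : ℝ) : EReal)) atTop
      (𝓝 (horofunction p ξ z : EReal)) :=
  (continuous_coe_real_ereal.tendsto _).comp (tendsto_horofunction_apply p z h)

theorem liminf_le_horofunction {x : EndCompactification K}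
    {ξ : FunctionsModConstants (KobayashiSpace hΩ)} (hξ : ξ ∈ metricFiber hΩ K x)
    (p z : KobayashiSpace hΩ) :
    liminf (fun w => ((dist z w - dist p w : ℝ) : EReal)) (comap (toEnd hΩ K) (𝓝 x)) ≤
      (horofunction p ξ z : EReal) := by
  obtain ⟨-, u, hux, huξ⟩ := hξ
  have hlim := tendsto_coe_of_mem_metricFiber huξ p z
  have hu : Tendsto u atTop (comap (toEnd hΩ K) (𝓝 x)) := tendsto_comap_iff.2 hux
  rw [← hlim.liminf_eq]
  exact liminf_le_liminf_of_le hu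

theorem horofunction_le_limsup {x : EndCompactification K}
    {ξ : FunctionsModConstants (KobayashiSpace hΩ)} (hξ : ξ ∈ metricFiber hΩ K x)
    (p z : KobayashiSpace hΩ) : (horofunction p ξ z : EReal) ≤
      limsup (fun w => ((dist z w - dist p w : ℝ) : EReal)) (comap (toEnd hΩ K) (𝓝 x)) := by
  obtain ⟨-, u, hux, huξ⟩ := hξ
  have hlim := tendsto_coe_of_mem_metricFiber huξ p z
  have hu : Tendsto u atTop (comap (toEnd hΩ K) (𝓝 x)) := tendsto_comap_iff.2 hux
  rw [← hlim.limsup_eq]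
  exact limsup_le_limsup_of_le hu (u := fun w => ((dist z w - dist p w : ℝ) : EReal))

variable [FiniteDimensional ℂ E] [T2Space X] [SecondCountableTopology X]

/-- A sequence in `Ω` that converges to a boundary point of the end compactification has a
subsequence that converges to a metric boundary point. -/
theorem exists_subseq_mem_metricFiber {x : EndCompactification K}
    (hx : x ∈ endBoundary hΩ K) (u : ℕ → KobayashiSpace hΩ)
    (hu : Tendsto (fun n => toEnd hΩ K (u n)) atTop (𝓝 x)) :
    ∃ ξ ∈ metricFiber hΩ K x, ∃ φ : ℕ → ℕ, StrictMono φ ∧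
      Tendsto (fun n => metricEmbedding (u (φ n))) atTop (𝓝 ξ) := by
  have := KobayashiSpace.locallyCompactSpace hΩ
  have := KobayashiSpace.secondCountableTopology hΩ
  obtain ⟨ξ, hξ, φ, hφ, hlim⟩ := exists_subseq_tendsto_metricEmbedding (u 0) u
  have hux := hu.comp hφ.tendsto_atTop
  refine ⟨ξ, ⟨⟨hξ, ?_⟩, fun n => u (φ n), hux, hlim⟩, φ, hφ, hlim⟩
  -- If the limit came from `y`, the subsequence would converge to `y` in the manifold topology as
  -- well, forcing `x` to be a point of `Ω`.
  rintro ⟨y, rfl⟩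
  have huy : Tendsto (fun n => u (φ n)) atTop (𝓝 y) :=
    tendsto_of_tendsto_metricEmbedding
      (fun z w r ε => KobayashiSpace.exists_dist_eq_dist_le z w) hlim
  exact hx.2 ⟨y, (eq_point_of_tendsto hux
    (((KobayashiSpace.continuous_val hΩ).subtype_mk _).continuousAt.tendsto.comp huy)).symm⟩

end HorosphereDescription

end Horospheres

theorem lemma4p1 {E : Type*} [NormedAddCommGroup E] [NormedSpace ℂ E] [FiniteDimensional ℂ E]
    {X : Type*} [TopologicalSpace X] [T2Space X] [SecondCountableTopology X]
    [ChartedSpace E X] [IsManifold 𝓘(ℂ, E) 1 X]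
    (Ω : Set X) (hne : Ω ≠ univ) (hΩ : IsHyperbolicDomain E Ω)
    (K : CompactExhaustion (closure Ω)) (hK : SeqCompactSpace (EndCompactification K))
    (p : KobayashiSpace hΩ) (R : ℝ) (hR : 0 < R)
    (x : EndCompactification K) (hx : x ∈ endBoundary hΩ K) :
    bigHorosphere hΩ K p x R = (⋃ ξ ∈ metricFiber hΩ K x, horoball p ξ R) ∧
    smallHorosphere hΩ K p x R = (⋂ ξ ∈ metricFiber hΩ K x, horoball p ξ R) := by
  have := firstCountableTopology_endCompactification (K := K)
  constructor
  · ext z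
    simp only [bigHorosphere, horoball, mem_iUnion, mem_ofPred_eq, exists_prop]
    constructor
    · intro hz
      -- The intermediate `c` keeps the inequality strict after passing to the limit.
      obtain ⟨c, hzc, hcR⟩ := EReal.lt_iff_exists_real_btwn.1 hz
      obtain ⟨u, hu, hlt⟩ := exists_seq_forall_of_frequently 
        (frequently_lt_of_liminf_lt (by isBoundedDefault) hzc)
      obtain ⟨ξ, hξ, φ, -, hlim⟩ := exists_subseq_mem_metricFiber hx u
        (tendsto_comap_iff (g := toEnd hΩ K).1 hu)
      refine ⟨ξ, hξ, lt_of_le_of_lt ?_ (EReal.coe_lt_coe_iff.1 hcR)⟩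
      exact le_of_tendsto' (tendsto_horofunction_apply p z hlim)
        fun n => (EReal.coe_lt_coe_iff.1 (hlt (φ n))).le
    · rintro ⟨ξ, hξ, hz⟩
      exact (liminf_le_horofunction hξ p z).trans_lt (EReal.coe_lt_coe_iff.2 hz)
  · ext z
    simp only [smallHorosphere, horoball, mem_iInter, mem_ofPred_eq]
    constructor
    · exact fun hz ξ hξ =>
        EReal.coe_lt_coe_iff.1 ((horofunction_le_limsup hξ p z).trans_lt hz)
    · intro hz
      by_contra! hle
      -- The limsup may equal `1 / 2 * Real.log R`, so the sequence is chosen with an error `1 / (n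
      -- + 1)` that vanishes in the limit.
      obtain ⟨B, hB⟩ := (comap (toEnd hΩ K) (𝓝 x)).exists_antitone_basis
      have hex : ∀ n : ℕ, ∃ w ∈ B n,
          1 / 2 * Real.log R - 1 / ((n : ℝ) + 1) < dist z w - dist p w := fun n => by
        have hlt : ((1 / 2 * Real.log R - 1 / ((n : ℝ) + 1) : ℝ) : EReal) <
            limsup (fun w => ((dist z w - dist p w : ℝ) : EReal))
              (comap (toEnd hΩ K) (𝓝 x)) :=
          lt_of_lt_of_le (EReal.coe_lt_coe_iff.2 (sub_lt_self _ Nat.one_div_pos_of_nat)) hle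
        obtain ⟨w, hw, hwB⟩ :=
          ((frequently_lt_of_lt_limsup (by isBoundedDefault) hlt).and_eventually (hB.mem n)).exists
        exact ⟨w, hwB, EReal.coe_lt_coe_iff.1 hw⟩
      choose u huB hu using hex
      obtain ⟨ξ, hξ, φ, hφ, hlim⟩ := exists_subseq_mem_metricFiber hx u
        (tendsto_comap_iff (g := toEnd hΩ K).1 (hB.tendsto huB))
      refine absurd (hz ξ hξ) (not_lt.2 ?_)
      have hc := tendsto_const_nhds (x := 1 / 2 * Real.log R) |>.sub
        (tendsto_one_div_add_atTop_nhds_zero_nat (𝕜 := ℝ) |>.comp hφ.tendsto_atTop)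
      rw [sub_zero] at hc
      exact le_of_tendsto_of_tendsto' hc (tendsto_horofunction_apply p z hlim)
        fun n => (hu (φ n)).le
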